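/- Let $G=(V,E)$ be a digraph with finite vertex set $V$ and arc set $E\subseteq V^2$ (loops allowed), write $w_{ij}$ for the arc from $i$ to $j$, and call $G$ bi-directed if $(i,j)\in E$ implies $(j,i)\in E$. Let $\mathcal M$ be the monoid generated by the arcs of $G$ subject to the relations $w_{ij}w_{kl}=w_{kl}w_{ij}$ for all arcs with $i\neq k$. A hike is an element of $\mathcal M$ in which, for every vertex $i$, the number of arcs starting at $i$ equals the number of arcs ending at $i$ (arcs counted with multiplicity). The hikes form a submonoid $\mathcal H$ of $\mathcal M$. Let $P_G$ be the set $\mathcal H$ partially ordered by left division ($h\preceq h'$ if and only if $h'=hd$ for some $d\in\mathcal H$), and let $\ell(h)$ be the number of arcs of $h$, counted with multiplicity. A backtrack is a hike $w_{ij}w_{ji}$ with $i\ne j$. **Proposition.** Let $G$ be a (non-empty) connected bi-directed digraph. Then: 1. A hike $h$ is a backtrack if and only if it is a minimal element of $P_G\setminus\{1\}$ and $\ell(h)=2$. 2. The graph whose vertices are the backtracks of $G$, two of them being adjacent when they do not commute, is isomorphic to the line graph of the underlying simple graph of $G$ (loops deleted). 3. The hike structure $(P_G,\ell)$ determines $G$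 up to isomorphism: if $G'$ is a connected bi-directed digraph and there is an isomorphism of posets $\varphi:P_G\to P_{G'}$ with $\ell(\varphi(h))=\ell(h)$ for all $h\in P_G$, then $G$ and $G'$ are isomorphic digraphs. -/

import Mathlib

namespace HikePoset

universe u v

variable {V : Type u}

/-- The arcs of a digraph: ordered pairs `(i, j)` with an arc from `i` to `j` (loops allowed). -/
def Arc (G : Digraph V) : Type u := {p : V × V // G.Adj p.1 p.2}

/-- The starting vertex of an arc. -/
def Arc.src {G : Digraph V} (a : Arc G) : V := a.1.1

/-- The end vertex of an arc. -/
def Arc.tgt {G : Digraph V} (a : Arc G) : V := a.1.2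

/-- The commutation rule: `ab = ba` for two arcs `a`, `b` with different starting vertices. -/
def ArcComm (G : Digraph V) (x y : FreeMonoid (Arc G)) : Prop :=
  ∃ a b : Arc G, a.src ≠ b.src ∧
    x = FreeMonoid.of a * FreeMonoid.of b ∧ y = FreeMonoid.of b * FreeMonoid.of a

/-- The trace monoid on the arcs of `G`. -/
abbrev TraceMonoid (G : Digraph V) : Type u := PresentedMonoid (ArcComm G)

/-- An arc as a trace. -/
abbrev arcTrace {G : Digraph V} (a : Arc G) : TraceMonoid G := PresentedMonoid.of (ArcComm G) a

/-- For a set `S` of arcs, the number of occurrences in a trace of arcs from `S`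
(written multiplicatively in order to be a monoid homomorphism). -/
noncomputable def countHom (G : Digraph V) (S : Set (Arc G)) :
    TraceMonoid G →* Multiplicative ℕ := by
  classical
  exact PresentedMonoid.lift (fun a => Multiplicative.ofAdd (if a ∈ S then 1 else 0)) (by
    rintro _ _ ⟨a, b, -, rfl, rfl⟩
    simp only [map_mul]
    exact mul_comm _ _)

/-- The number of occurrences in the trace `t` of arcs from the set `S`. -/
noncomputable def arcCount {G : Digraph V} (S : Set (Arc G)) (t : TraceMonoid G) : ℕ :=
  (countHom G S t).toAdd

theorem arcCount_one {G : Digraph V} (S : Set (Arc G)) : arcCount S (1 : TraceMonoid G) = 0 := by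
  simp [arcCount]

theorem arcCount_mul {G : Digraph V} (S : Set (Arc G)) (s t : TraceMonoid G) :
    arcCount S (s * t) = arcCount S s + arcCount S t := by
  simp [arcCount]

theorem arcCount_arcTrace {G : Digraph V} (S : Set (Arc G)) [DecidablePred (· ∈ S)] (a : Arc G) :
    arcCount S (arcTrace a) = if a ∈ S then 1 else 0 := by
  unfold arcCount countHom
  rw [PresentedMonoid.lift_of, toAdd_ofAdd]
  congr

/-- The hikes: traces in which, at every vertex, the number of outgoing arcs is the number of
ingoing arcs. -/
def hikes (G : Digraph V) : Submonoid (TraceMonoid G) where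
  carrier := {t | ∀ i : V, arcCount {a | a.src = i} t = arcCount {a | a.tgt = i} t}
  one_mem' := fun i => by simp only [arcCount_one]
  mul_mem' := fun {s t} hs ht i => by
    have h1 := hs i
    have h2 := ht i
    simp only [arcCount_mul, h1, h2]

/-- The type of hikes on `G`. -/
def Hike (G : Digraph V) : Type u := hikes G

/-- Multiplication of hikes is concatenation. -/
instance (G : Digraph V) : Monoid (Hike G) := inferInstanceAs (Monoid (hikes G))

/-- The trace underlying a hike. -/
def Hike.toTrace {G : Digraph V} (h : Hike G) : TraceMonoid G := h.1

/-- The length of a hike: its number of arcs, counted with multiplicity. -/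
noncomputable def Hike.length {G : Digraph V} (h : Hike G) : ℕ := arcCount Set.univ h.toTrace

theorem Hike.length_mul {G : Digraph V} (h k : Hike G) :
    (h * k).length = h.length + k.length := arcCount_mul _ _ _

theorem Hike.eq_one_of_length {G : Digraph V} (h : Hike G) (h0 : h.length = 0) : h = 1 := by
  have key : ∀ t : TraceMonoid G, arcCount Set.univ t = 0 → t = 1 := by
    classical
    intro t
    obtain ⟨w, rfl⟩ := PresentedMonoid.surjective_mk t
    induction w using FreeMonoid.inductionOn' with
    | one => intro _; exact map_one _
    | of_mul a w _ =>
      intro hw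
      rw [map_mul, arcCount_mul] at hw
      have := arcCount_arcTrace (G := G) Set.univ a
      simp only [Set.mem_univ, if_true] at this
      change arcCount Set.univ (arcTrace a) + _ = 0 at hw
      omega
  exact Subtype.ext (key h.1 h0)

/-- The poset of hikes, ordered by left division: `h ≤ k` iff `k = h * d` for some hike `d`. -/
instance (G : Digraph V) : PartialOrder (Hike G) where
  le h k := ∃ d : Hike G, k = h * d
  le_refl h := ⟨1, (mul_one h).symm⟩
  le_trans := by
    rintro a b c ⟨d, rfl⟩ ⟨e, rfl⟩
    exact ⟨d * e, mul_assoc a d e⟩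
  le_antisymm := by
    rintro a b ⟨d, hd⟩ ⟨e, he⟩
    have h1 := congrArg Hike.length hd
    have h2 := congrArg Hike.length he
    rw [Hike.length_mul] at h1 h2
    have h3 : d = 1 := d.eq_one_of_length (by omega)
    rw [hd, h3, mul_one]

/-- The backtracks: the hikes consisting of an arc from `i` to `j` and an arc from `j` to `i`,
where `i ≠ j`. -/
def IsBacktrack {G : Digraph V} (h : Hike G) : Prop :=
  ∃ a b : Arc G, a.src ≠ a.tgt ∧ b.src = a.tgt ∧ b.tgt = a.src ∧
    h.toTrace = arcTrace a * arcTrace b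

/-- The graph on the backtracks of `G` in which two backtracks are adjacent iff they do not
commute. -/
def backtrackGraph (G : Digraph V) : SimpleGraph {h : Hike G // IsBacktrack h} where
  Adj b c := b.1 * c.1 ≠ c.1 * b.1
  symm := ⟨fun _ _ h => Ne.symm h⟩
  loopless := ⟨fun _ h => h rfl⟩

/-- A digraph is bi-directed if every arc comes with the opposite arc. Loops are allowed. -/
def IsBidirected (G : Digraph V) : Prop := ∀ i j : V, G.Adj i j → G.Adj j i

/-- A digraph is connected if its underlying undirected graph is (in particular it has a vertex). -/
def IsConnected (G : Digraph V) : Prop := G.toSimpleGraphInclusive.Connected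

/-- Two digraphs have the same hike structure: there is an isomorphism of their hike posets that
preserves the length of hikes. -/
def SameHikeStructure {W : Type v} (G : Digraph V) (H : Digraph W) : Prop :=
  ∃ e : Hike G ≃o Hike H, ∀ h : Hike G, (e h).length = h.length

end HikePoset

namespace HikePoset

universe u v

/-- A bijection between the edges of two simple graphs that preserves and reflects whether two
edges share a vertex, written as a relation: `T x y a b` says that the edge `xy` corresponds to
the edge `ab`. -/
structure EdgeCorr {V : Type u} {W : Type v} (S : SimpleGraph V) (S' : SimpleGraph W)
    (T : V → V → W → W → Prop) : Prop where
  left : ∀ {x y a b}, T x y a b → S.Adj x y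
  right : ∀ {x y a b}, T x y a b → S'.Adj a b
  swap_left : ∀ {x y a b}, T x y a b → T y x a b
  swap_right : ∀ {x y a b}, T x y a b → T x y b a
  total_left : ∀ {x y}, S.Adj x y → ∃ a b, T x y a b
  total_right : ∀ {a b}, S'.Adj a b → ∃ x y, T x y a b
  meet : ∀ {x y a b x' y' a' b'}, T x y a b → T x' y' a' b' →
    ((x = x' ∨ x = y' ∨ y = x' ∨ y = y') ↔ (a = a' ∨ a = b' ∨ b = a' ∨ b = b'))
  same : ∀ {x y a b x' y' a' b'}, T x y a b → T x' y' a' b' →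
    ((x = x' ∧ y = y' ∨ x = y' ∧ y = x') ↔ (a = a' ∧ b = b' ∨ a = b' ∧ b = a'))

/-- A bijection between two sets of vertices that is compatible, in terms of incidence, with a
given correspondence of edges. -/
structure LoopCorr {V : Type u} {W : Type v} (L : V → Prop) (L' : W → Prop)
    (T : V → V → W → W → Prop) (R : V → W → Prop) : Prop where
  left : ∀ {v w}, R v w → L v
  right : ∀ {v w}, R v w → L' w
  total_left : ∀ {v}, L v → ∃ w, R v w
  total_right : ∀ {w}, L' w → ∃ v, R v w
  same : ∀ {v w v' w'}, R v w → R v' w' → (v = v' ↔ w = w')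
  inc : ∀ {x y a b v w}, T x y a b → R v w → ((x = v ∨ y = v) ↔ (a = w ∨ b = w))

/-- The vertex `v` lies on exactly those edges whose corresponding edges contain `v'`. -/
def StarMatch {V : Type u} {W : Type v} (T : V → V → W → W → Prop) (v : V) (v' : W) : Prop :=
  ∀ x y a b, T x y a b → ((x = v ∨ y = v) ↔ (a = v' ∨ b = v'))

/-- Three edges with a common vertex correspond to three edges with a common vertex. -/
def PreservesStars {V : Type u} {W : Type v} (T : V → V → W → W → Prop) : Prop :=
  ∀ v x y z a b c d e f, T v x a b → T v y c d → T v z e f →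
    ∃ v', (a = v' ∨ b = v') ∧ (c = v' ∨ d = v') ∧ (e = v' ∨ f = v')

section
variable {V : Type u} {W : Type v} {S : SimpleGraph V} {S' : SimpleGraph W}
  {T : V → V → W → W → Prop} {L : V → Prop} {L' : W → Prop} {R : V → W → Prop}

theorem EdgeCorr.symm (h : EdgeCorr S S' T) : EdgeCorr S' S (fun a b x y => T x y a b) where
  left := h.right
  right := h.left
  swap_left := h.swap_right
  swap_right := h.swap_left
  total_left := h.total_right
  total_right := h.total_left
  meet h1 h2 := (h.meet h1 h2).symm
  same h1 h2 := (h.same h1 h2).symm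

theorem LoopCorr.symm (h : LoopCorr L L' T R) :
    LoopCorr L' L (fun a b x y => T x y a b) (fun w v => R v w) where
  left := h.right
  right := h.left
  total_left := h.total_right
  total_right := h.total_left
  same h1 h2 := (h.same h1 h2).symm
  inc h1 h2 := (h.inc h1 h2).symm

theorem StarMatch.symm {v : V} {v' : W} (h : StarMatch T v v') :
    StarMatch (fun a b x y => T x y a b) v' v :=
  fun x y a b hT => (h a b x y hT).symm

theorem mem_of_closed_of_connected (hS : S.Connected) {p : V → Prop} {a : V} (ha : p a)
    (hp : ∀ x y, p x → S.Adj x y → p y) (v : V) : p v := by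
  obtain ⟨w⟩ := hS.preconnected a v
  induction w with
  | nil => exact ha
  | cons hxy _ ih => exact ih (hp _ _ ha hxy)

theorem EdgeCorr.mem_of_star (h : EdgeCorr S S' T) (hs : PreservesStars T) {v x y q : V}
    {v' b d a c : W} (h1 : T v x v' b) (h2 : T v y v' d) (hxy : x ≠ y) (h3 : T v q a c) :
    a = v' ∨ c = v' := by
  have e12 := h.same h1 h2
  have := hs _ _ _ _ _ _ _ _ _ _ h1 h2 h3
  grind

theorem EdgeCorr.exists_common (h : EdgeCorr S S' T) {v x y : V} (hx : S.Adj v x)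
    (hy : S.Adj v y) : ∃ v' b d, T v x v' b ∧ T v y v' d := by
  obtain ⟨a, b, h1⟩ := h.total_left hx
  obtain ⟨c, d, h2⟩ := h.total_left hy
  have h1' := h.swap_right h1
  have h2' := h.swap_right h2
  rcases (h.meet h1 h2).1 (Or.inl rfl) with rfl | rfl | rfl | rfl
  exacts [⟨_, _, _, h1, h2⟩, ⟨_, _, _, h1, h2'⟩, ⟨_, _, _, h1', h2⟩, ⟨_, _, _, h1', h2'⟩]

theorem EdgeCorr.exists_starMatch_of_two (h : EdgeCorr S S' T) (hs : PreservesStars T)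
    (hs' : PreservesStars (fun a b x y => T x y a b)) {v x y : V} (hx : S.Adj v x)
    (hy : S.Adj v y) (hxy : x ≠ y) : ∃ v', StarMatch T v v' := by
  obtain ⟨v', b, d, h1, h2⟩ := h.exists_common hx hy
  have hbd : b ≠ d := by
    have := h.same h1 h2
    have := (h.left h1).ne
    grind
  refine ⟨v', fun p q a c hT => ⟨?_, ?_⟩⟩
  · rintro (rfl | rfl)
    · exact h.mem_of_star hs h1 h2 hxy hT
    · exact h.mem_of_star hs h1 h2 hxy (h.swap_left hT)
  · rintro (rfl | rfl)
    · exact h.symm.mem_of_star hs' h1 h2 hbd hT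
    · exact h.symm.mem_of_star hs' h1 h2 hbd (h.swap_right hT)

theorem exists_two_neighbors_of_leaf (hS : S.Connected) {v w : V} 
    (hleaf : ∀ y, S.Adj v y → y = w) (h3 : ∃ z, z ≠ v ∧ z ≠ w) : ∃ z, S.Adj w z ∧ z ≠ v := by
  by_contra! hcon
  obtain ⟨z, hz⟩ := h3
  have := mem_of_closed_of_connected hS (p := fun x => x = v ∨ x = w) (Or.inl rfl) (by grind) z
  grind

theorem EdgeCorr.exists_starMatch (h : EdgeCorr S S' T) (hS : S.Connected)
    (hs : PreservesStars T) (hs' : PreservesStars (fun a b x y => T x y a b))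
    (h3 : ∀ v w : V, ∃ z, z ≠ v ∧ z ≠ w) (v : V) : ∃ v', StarMatch T v v' := by
  have : Nontrivial V := by
    obtain ⟨z, hz, -⟩ := h3 v v
    exact ⟨z, v, hz⟩
  obtain ⟨w, hvw⟩ := hS.preconnected.exists_adj_of_nontrivial v
  by_cases hleaf : ∀ y, S.Adj v y → y = w
  · obtain ⟨z, hwz, hzv⟩ := exists_two_neighbors_of_leaf hS hleaf (h3 v w)
    obtain ⟨w', hw'⟩ := h.exists_starMatch_of_two hs hs' hvw.symm hwz hzv.symm
    obtain ⟨v', hT⟩ : ∃ v', T v w v' w' := by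
      obtain ⟨a, b, hT⟩ := h.total_left hvw
      rcases (hw' _ _ _ _ hT).1 (Or.inr rfl) with rfl | rfl
      exacts [⟨_, h.swap_right hT⟩, ⟨_, hT⟩]
    refine ⟨v', fun p q a c hT' => ?_⟩
    have e1 := h.meet hT hT'
    have e2 := h.same hT hT'
    have e3 := hw' _ _ _ _ hT'
    have e4 := h.left hT'
    have e5 := h.right hT'
    have e6 := e4.symm
    have e7 := h.right hT
    have e8 := e5.ne
    have e9 := e7.ne
    have e10 := e4.ne
    have e11 := hvw.ne
    constructor
    · rintro (rfl | rfl)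
      · have := hleaf _ e4
        grind
      · have := hleaf _ e6
        grind
    · intro hv
      by_contra hn
      grind
  · push Not at hleaf
    obtain ⟨y, hy, hyw⟩ := hleaf
    exact h.exists_starMatch_of_two hs hs' hy hvw hyw

theorem EdgeCorr.eq_of_starMatch (h : EdgeCorr S S' T) (hS : S.Connected)
    (h3 : ∀ v w : V, ∃ z, z ≠ v ∧ z ≠ w) {v w : V} {v' : W} (hv : StarMatch T v v')
    (hw : StarMatch T w v') : v = w := by
  by_contra hne
  have key : ∀ x y, S.Adj x y → ((x = v ∨ y = v) ↔ (x = w ∨ y = w)) := by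
    intro x y hxy
    obtain ⟨a, b, hT⟩ := h.total_left hxy
    rw [hv _ _ _ _ hT, hw _ _ _ _ hT]
  obtain ⟨z, hz⟩ := h3 v w
  have := mem_of_closed_of_connected hS (p := fun x => x = v ∨ x = w) (Or.inl rfl) (by grind) z
  grind

/-- An isomorphism of simple graphs that also matches two vertex predicates. -/
def LoopIso (S : SimpleGraph V) (S' : SimpleGraph W) (L : V → Prop) (L' : W → Prop) : Prop :=
  ∃ f : V ≃ W, (∀ x y, S.Adj x y ↔ S'.Adj (f x) (f y)) ∧ ∀ x, L x ↔ L' (f x)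

theorem LoopIso.symm (h : LoopIso S S' L L') : LoopIso S' S L' L := by
  obtain ⟨f, h1, h2⟩ := h
  exact ⟨f.symm, fun x y => by simp [h1], fun x => by simp [h2]⟩

theorem EdgeCorr.loopIso_of_preservesStars (h : EdgeCorr S S' T) (hl : LoopCorr L L' T R)
    (hS : S.Connected) (hS' : S'.Connected)
    (hs : PreservesStars T) (hs' : PreservesStars (fun a b x y => T x y a b))
    (h3 : ∀ v w : V, ∃ z, z ≠ v ∧ z ≠ w) (h3' : ∀ v w : W, ∃ z, z ≠ v ∧ z ≠ w) :
    LoopIso S S' L L' := by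
  choose f hf using h.exists_starMatch hS hs hs' h3
  choose g hg using h.symm.exists_starMatch hS' hs' hs h3'
  have hgf : ∀ v, g (f v) = v := fun v => h.eq_of_starMatch hS h3 (hg (f v)).symm (hf v)
  have hfg : ∀ w, f (g w) = w := fun w => h.symm.eq_of_starMatch hS' h3' (hf (g w)).symm (hg w)
  refine ⟨⟨f, g, hgf, hfg⟩, fun x y => ?_, fun x => ?_⟩
  · simp only [Equiv.coe_fn_mk]
    constructor
    · intro hxy
      obtain ⟨a, b, hT⟩ := h.total_left hxy
      have e1 := hf x _ _ _ _ hT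
      have e2 := hf y _ _ _ _ hT
      have e3 := h.right hT
      have e4 := e3.symm
      have e5 : f x ≠ f y := fun e => hxy.ne (by rw [← hgf x, ← hgf y, e])
      grind
    · intro hxy
      obtain ⟨a, b, hT⟩ := h.total_right hxy
      have e1 := hf x _ _ _ _ hT
      have e2 := hf y _ _ _ _ hT
      have e3 := h.left hT
      have e4 := e3.symm
      have e5 : x ≠ y := fun e => hxy.ne (by rw [e])
      grind
  · simp only [Equiv.coe_fn_mk]
    constructor
    · intro hx
      obtain ⟨w, hw⟩ := hl.total_left hx
      have : w = f x := h.symm.eq_of_starMatch hS' h3' (v' := x)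
        (fun a b p q hT => (hl.inc hT hw).symm) (hf x).symm
      exact this ▸ hl.right hw
    · intro hx
      obtain ⟨v, hv⟩ := hl.total_right hx
      have : v = x := h.eq_of_starMatch hS h3 (v' := f x)
        (fun a b p q hT => (hl.inc hT hv)) (hf x)
      exact this ▸ hl.left hv

end

section
variable {V : Type u} {W : Type v} {S : SimpleGraph V} {S' : SimpleGraph W}
  {T : V → V → W → W → Prop} {L : V → Prop} {L' : W → Prop} {R : V → W → Prop}

theorem loopIso_of_two {v w : V} {a b : W} (hV : ∀ z, z = v ∨ z = w) (hW : ∀ z, z = a ∨ z = b)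
    (hvw : S.Adj v w) (hab : S'.Adj a b) (h1 : L v ↔ L' a) (h2 : L w ↔ L' b) :
    LoopIso S S' L L' := by
  classical
  have e1 := hvw.ne
  have e2 := hab.ne
  refine ⟨⟨fun x => if x = v then a else b, fun x => if x = a then v else w, ?_, ?_⟩, ?_, ?_⟩
  · intro x
    have := hV x
    grind
  · intro x
    have := hW x
    grind
  · intro x y
    have := hvw.symm
    have := hab.symm
    rcases hV x with rfl | rfl <;> rcases hV y with rfl | rfl <;> simp [*, e1.symm]
  · intro x
    rcases hV x with rfl | rfl <;> simp [*, e1.symm]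

theorem EdgeCorr.loopIso_of_small (h : EdgeCorr S S' T) (hl : LoopCorr L L' T R)
    (hS : S.Connected) (hS' : S'.Connected) (h2 : ∃ v w : V, ∀ z, z = v ∨ z = w) :
    LoopIso S S' L L' := by
  obtain ⟨v, w, hV⟩ := h2
  by_cases hvw : S.Adj v w
  · have hne := hvw.ne
    obtain ⟨a, b, hT⟩ := h.total_left hvw
    have hab := h.right hT
    have hW : ∀ z, z = a ∨ z = b := by
      refine mem_of_closed_of_connected hS' (Or.inl rfl) fun x y _ hxy => ?_
      obtain ⟨p, q, hT'⟩ := h.total_right hxy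
      have e1 := h.same hT hT'
      have e2 := (h.left hT').ne
      have e3 := hV p
      have e4 := hV q
      grind
    have hL : ∀ {x}, L x → R x a ∨ R x b := fun hx => by
      obtain ⟨z, hz⟩ := hl.total_left hx
      rcases hW z with rfl | rfl
      exacts [Or.inl hz, Or.inr hz]
    have hL' : ∀ {z}, L' z → R v z ∨ R w z := fun hz => by
      obtain ⟨x, hx⟩ := hl.total_right hz
      rcases hV x with rfl | rfl
      exacts [Or.inl hx, Or.inr hx]
    have e1 := hab.ne
    have e2 := @hl.left
    have e3 := @hl.right
    have e6 := @hl.same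
    by_cases hR : R v b ∨ R w a
    · have hL : (L v ↔ L' b) ∧ (L w ↔ L' a) := by
        have e7 := @hL v
        have e8 := @hL w
        have e9 := @hL' a
        have e10 := @hL' b
        grind
      exact loopIso_of_two hV (fun z => (hW z).symm) hvw hab.symm hL.1 hL.2
    · have hL : (L v ↔ L' a) ∧ (L w ↔ L' b) := by
        have e7 := @hL v
        have e8 := @hL w
        have e9 := @hL' a
        have e10 := @hL' b
        grind
      exact loopIso_of_two hV hW hvw hab hL.1 hL.2
  · have hE : ∀ x y, ¬ S.Adj x y := by
      intro x y hxy
      have := hxy.ne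
      have := hxy.symm
      have := hV x
      have := hV y
      grind
    have hE' : ∀ x y, ¬ S'.Adj x y := by
      intro x y hxy
      obtain ⟨p, q, hT⟩ := h.total_right hxy
      exact hE _ _ (h.left hT)
    have hv : ∀ z, z = v :=
      mem_of_closed_of_connected hS rfl fun x y _ hxy => (hE _ _ hxy).elim
    obtain ⟨a⟩ := hS'.nonempty
    have ha : ∀ z, z = a :=
      mem_of_closed_of_connected hS' rfl fun x y _ hxy => (hE' _ _ hxy).elim
    refine ⟨⟨fun _ => a, fun _ => v, fun z => (hv z).symm, fun z => (ha z).symm⟩,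
      fun x y => iff_of_false (hE _ _) (hE' _ _), fun x => ?_⟩
    simp only [Equiv.coe_fn_mk]
    constructor
    · intro hx
      obtain ⟨w, hw⟩ := hl.total_left hx
      exact ha w ▸ hl.right hw
    · intro hx
      obtain ⟨w, hw⟩ := hl.total_right hx
      exact hv x ▸ hv w ▸ hl.left hw

/-- The edges of the triangle `ijk` correspond to the edges of the star with centre `a` and leaves
`b`, `c`, `d`. -/
structure TriangleToStar (T : V → V → W → W → Prop) (i j k : V) (a b c d : W) : Prop where
  jk : T j k a b
  ik : T i k a c
  ij : T i j a d

theorem TriangleToStar.ne (h : EdgeCorr S S' T) {i j k : V} {a b c d : W}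
    (ht : TriangleToStar T i j k a b c d) :
    (i ≠ j ∧ i ≠ k ∧ j ≠ k) ∧ a ≠ b ∧ a ≠ c ∧ a ≠ d ∧ b ≠ c ∧ b ≠ d ∧ c ≠ d := by
  have e1 := (h.left ht.jk).ne
  have e2 := (h.left ht.ik).ne
  have e3 := (h.left ht.ij).ne
  have e4 := (h.right ht.jk).ne
  have e5 := (h.right ht.ik).ne
  have e6 := (h.right ht.ij).ne
  have e7 := h.same ht.jk ht.ik
  have e8 := h.same ht.jk ht.ij
  have e9 := h.same ht.ik ht.ij
  grind

theorem TriangleToStar.rotate (h : EdgeCorr S S' T) {i j k : V} {a b c d : W}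
    (ht : TriangleToStar T i j k a b c d) : TriangleToStar T j k i a c d b :=
  ⟨h.swap_left ht.ik, h.swap_left ht.ij, ht.jk⟩

theorem TriangleToStar.reflect (h : EdgeCorr S S' T) {i j k : V} {a b c d : W}
    (ht : TriangleToStar T i j k a b c d) : TriangleToStar T i k j a b d c :=
  ⟨h.swap_left ht.jk, ht.ij, ht.ik⟩

/-- An edge that meets the triangle `ijk` exactly in `i` corresponds to `cd`. -/
theorem TriangleToStar.apex (h : EdgeCorr S S' T) {i j k l : V} {a b c d p q : W}
    (ht : TriangleToStar T i j k a b c d) (hT : T i l p q) (hj : l ≠ j) (hk : l ≠ k) :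
    T i l c d := by
  have e1 := h.meet ht.jk hT
  have e2 := h.meet ht.ik hT
  have e3 := h.meet ht.ij hT
  have e4 := ht.ne h
  have e5 := (h.left hT).ne
  have e6 := h.swap_right hT
  grind

theorem TriangleToStar.right_mem (h : EdgeCorr S S' T) (hS' : S'.Connected) {i j k : V}
    {a b c d : W} (ht : TriangleToStar T i j k a b c d) (z : W) :
    z = a ∨ z = b ∨ z = c ∨ z = d := by
  refine mem_of_closed_of_connected hS' (p := fun z => z = a ∨ z = b ∨ z = c ∨ z = d)
    (Or.inl rfl) (fun x y hx hxy => ?_) z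
  obtain ⟨p, q, hT⟩ := h.total_right hxy
  have e1 := h.meet ht.jk hT
  have e2 := h.meet ht.ik hT
  have e3 := h.meet ht.ij hT
  have f1 := h.same ht.jk hT
  have f2 := h.same ht.ik hT
  have f3 := h.same ht.ij hT
  have e4 := ht.ne h
  have e5 := (h.left hT).ne
  have e6 := hxy.ne
  grind

theorem TriangleToStar.no_loop (h : EdgeCorr S S' T) (hl : LoopCorr L L' T R)
    (hS' : S'.Connected) {i j k : V}
    {a b c d : W} (ht : TriangleToStar T i j k a b c d) (v : V) : ¬ L v := by
  intro hv
  obtain ⟨w, hw⟩ := hl.total_left hv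
  have e1 := hl.inc ht.jk hw
  have e2 := hl.inc ht.ik hw
  have e3 := hl.inc ht.ij hw
  have e4 := ht.ne h
  have e5 := ht.right_mem h hS' w
  grind

theorem TriangleToStar.left_mem (h : EdgeCorr S S' T) (hS : S.Connected) {i j k l : V}
    {a b c d : W} (ht : TriangleToStar T i j k a b c d) (hil : S.Adj i l) (hj : l ≠ j)
    (hk : l ≠ k) (z : V) : z = i ∨ z = j ∨ z = k ∨ z = l := by
  obtain ⟨p, q, hT⟩ := h.total_left hil
  replace hT := ht.apex h hT hj hk
  refine mem_of_closed_of_connected hS (p := fun z => z = i ∨ z = j ∨ z = k ∨ z = l)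
    (Or.inl rfl) (fun x y hx hxy => ?_) z
  obtain ⟨p, q, hT'⟩ := h.total_left hxy
  have e1 := h.meet ht.jk hT'
  have e2 := h.meet ht.ik hT'
  have e3 := h.meet ht.ij hT'
  have e0 := h.meet hT hT'
  have f0 := h.same hT hT'
  have e4 := ht.ne h
  have e5 := hxy.ne
  have e6 := (h.right hT').ne
  have e7 := hil.ne
  grind

theorem TriangleToStar.adj_iff (h : EdgeCorr S S' T) (hS : S.Connected) {i j k l : V}
    {a b c d : W} (ht : TriangleToStar T i j k a b c d) (hil : S.Adj i l) (hj : l ≠ j)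
    (hk : l ≠ k) : S.Adj j l ↔ S'.Adj b d := by
  have hmem := ht.left_mem h hS hil hj hk
  constructor
  · intro hjl
    obtain ⟨p, q, hT⟩ := h.total_left hjl
    have := (ht.rotate h).apex h hT hk hil.ne'
    exact (h.right this).symm
  · intro hbd
    obtain ⟨p, q, hT⟩ := h.total_right hbd
    have e1 := h.meet ht.jk hT
    have e2 := h.meet ht.ik hT
    have e3 := h.meet ht.ij hT
    have e4 := ht.ne h
    have e5 := h.left hT
    have e6 := e5.ne
    have e7 := e5.symm
    have e8 := hmem p
    have e9 := hmem q
    grind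

theorem TriangleToStar.loopIso_of_adj (h : EdgeCorr S S' T) (hl : LoopCorr L L' T R)
    (hS : S.Connected) (hS' : S'.Connected) {i j k l : V}
    {a b c d : W} (ht : TriangleToStar T i j k a b c d) (hil : S.Adj i l) (hj : l ≠ j)
    (hk : l ≠ k) : LoopIso S S' L L' := by
  classical
  have hV := ht.left_mem h hS hil hj hk
  have hW := ht.right_mem h hS'
  obtain ⟨⟨n1, n2, n3⟩, m1, m2, m3, m4, m5, m6⟩ := ht.ne h
  have hjl := ht.adj_iff h hS hil hj hk
  have hkl := (ht.reflect h).adj_iff h hS hil hk hj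
  have hi := hil.ne'
  obtain ⟨p, q, hT⟩ := h.total_left hil
  have hcd := h.right (ht.apex h hT hj hk)
  have a1 := h.left ht.jk
  have a2 := h.left ht.ik
  have a3 := h.left ht.ij
  have b1 := h.right ht.jk
  have b2 := h.right ht.ik
  have b3 := h.right ht.ij
  refine ⟨⟨fun x => if x = i then a else if x = j then d else if x = k then c else b,
    fun x => if x = a then i else if x = d then j else if x = c then k else l,
    ?_, ?_⟩, ?_, ?_⟩
  · intro x
    have := hV x
    grind
  · intro x
    have := hW x
    grind
  · intro x y
    have s := @S.adj_comm
    have s' := @S'.adj_comm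
    rcases hV x with rfl | rfl | rfl | rfl <;> rcases hV y with rfl | rfl | rfl | rfl <;>
      simp only [Equiv.coe_fn_mk] <;> grind [SimpleGraph.irrefl]
  · intro x
    refine iff_of_false (ht.no_loop h hl hS' x) fun hx => ?_
    obtain ⟨v, hv⟩ := hl.total_right hx
    exact ht.no_loop h hl hS' v (hl.left hv)

theorem TriangleToStar.loopIso (h : EdgeCorr S S' T) (hl : LoopCorr L L' T R)
    (hS : S.Connected) (hS' : S'.Connected)
    (hodd : ∀ a, (∀ x y, S'.Adj x y → x = a ∨ y = a) → (∀ w, ¬ L' w) →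
      ∀ i j k, S.Adj i j → S.Adj j k → S.Adj k i → False)
    {i j k : V} {a b c d : W} (ht : TriangleToStar T i j k a b c d) : LoopIso S S' L L' := by
  by_cases hex : ∃ x l, (x = i ∨ x = j ∨ x = k) ∧ l ≠ i ∧ l ≠ j ∧ l ≠ k ∧ S.Adj x l
  · obtain ⟨x, l, rfl | rfl | rfl, hi, hj, hk, hadj⟩ := hex
    · exact ht.loopIso_of_adj h hl hS hS' hadj hj hk
    · exact (ht.rotate h).loopIso_of_adj h hl hS hS' hadj hk hi
    · exact ((ht.rotate h).rotate h).loopIso_of_adj h hl hS hS' hadj hi hj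
  · have hV := mem_of_closed_of_connected hS (p := fun x => x = i ∨ x = j ∨ x = k) (Or.inl rfl)
      (by grind)
    refine (hodd a (fun x y hxy => ?_) (fun w hw => ?_) i j k (h.left ht.ij) (h.left ht.jk)
      (h.left ht.ik).symm).elim
    · obtain ⟨p, q, hT⟩ := h.total_right hxy
      have f1 := h.same ht.jk hT
      have f2 := h.same ht.ik hT
      have f3 := h.same ht.ij hT
      have e1 := (h.left hT).ne
      have e2 := hV p
      have e3 := hV q
      grind
    · obtain ⟨v, hv⟩ := hl.total_right hw
      exact ht.no_loop h hl hS' v (hl.left hv)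

/-- If the stars of the second graph are not preserved, then some triangle of the first graph
corresponds to a star. -/
theorem EdgeCorr.exists_triangleToStar (h : EdgeCorr S S' T)
    (hs : ¬ PreservesStars (fun a b x y => T x y a b)) :
    ∃ i j k a b c d, TriangleToStar T i j k a b c d := by
  simp only [PreservesStars, not_forall] at hs
  obtain ⟨a, b, c, d, j, k, p, q, r, s, h1, h2, h3, hn⟩ := hs
  have e1 := (h.meet h1 h2).2 (Or.inl rfl)
  have e2 := (h.meet h1 h3).2 (Or.inl rfl)
  have e3 := (h.meet h2 h3).2 (Or.inl rfl)
  have e4 := not_exists.1 hn j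
  have e5 := not_exists.1 hn k
  have h1' := h.swap_left h1
  have h2' := h.swap_left h2
  have h3' := h.swap_left h3
  have : ∃ i, T i k a c ∧ T i j a d ∨ T i j a c ∧ T i k a d := by
    by_cases hp : p = j ∨ p = k
    · refine ⟨q, ?_⟩
      grind
    · refine ⟨p, ?_⟩
      grind
  obtain ⟨i, ⟨h4, h5⟩ | ⟨h4, h5⟩⟩ := this
  · exact ⟨i, j, k, a, b, c, d, h1, h4, h5⟩
  · exact ⟨i, k, j, a, b, c, d, h1', h4, h5⟩

/-- **Whitney's theorem** for connected graphs with loops, where the exceptional pair formed by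
the triangle and the three-leaf star is excluded. -/
theorem EdgeCorr.loopIso (h : EdgeCorr S S' T) (hl : LoopCorr L L' T R)
    (hS : S.Connected) (hS' : S'.Connected)
    (hodd : ∀ a, (∀ x y, S'.Adj x y → x = a ∨ y = a) → (∀ w, ¬ L' w) →
      ∀ i j k, S.Adj i j → S.Adj j k → S.Adj k i → False)
    (hodd' : ∀ a, (∀ x y, S.Adj x y → x = a ∨ y = a) → (∀ w, ¬ L w) →
      ∀ i j k, S'.Adj i j → S'.Adj j k → S'.Adj k i → False) : LoopIso S S' L L' := by
  by_cases h2 : ∃ v w : V, ∀ z, z = v ∨ z = w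
  · exact h.loopIso_of_small hl hS hS' h2
  by_cases h2' : ∃ v w : W, ∀ z, z = v ∨ z = w
  · exact (h.symm.loopIso_of_small hl.symm hS' hS h2').symm
  by_cases hs : PreservesStars T
  · by_cases hs' : PreservesStars (fun a b x y => T x y a b)
    · push Not at h2 h2'
      exact h.loopIso_of_preservesStars hl hS hS' hs hs' h2 h2'
    · obtain ⟨i, j, k, a, b, c, d, ht⟩ := h.exists_triangleToStar hs'
      exact ht.loopIso h hl hS hS' hodd
  · obtain ⟨i, j, k, a, b, c, d, ht⟩ := h.symm.exists_triangleToStar hs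
    exact (ht.loopIso h.symm hl.symm hS' hS hodd').symm

end

section
variable {V : Type u} {G : Digraph V}

/-- The arc from `x` to `y`. -/
def arcOf {x y : V} (h : G.Adj x y) : Arc G := ⟨(x, y), h⟩

@[simp] theorem arcOf_src {x y : V} (h : G.Adj x y) : (arcOf h).src = x := rfl

@[simp] theorem arcOf_tgt {x y : V} (h : G.Adj x y) : (arcOf h).tgt = y := rfl

theorem Arc.exists_eq_arcOf (a : Arc G) : ∃ (x y : V) (h : G.Adj x y), a = arcOf h :=
  ⟨a.1.1, a.1.2, a.2, rfl⟩

theorem arcCount_src_arcOf [DecidableEq V] {x y : V} (h : G.Adj x y) (v : V) :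
    arcCount {a | a.src = v} (arcTrace (arcOf h)) = if x = v then 1 else 0 := by
  classical
  rw [arcCount_arcTrace]
  exact if_congr Iff.rfl rfl rfl

theorem arcCount_tgt_arcOf [DecidableEq V] {x y : V} (h : G.Adj x y) (v : V) :
    arcCount {a | a.tgt = v} (arcTrace (arcOf h)) = if y = v then 1 else 0 := by
  classical
  rw [arcCount_arcTrace]
  exact if_congr Iff.rfl rfl rfl

theorem arcCount_univ_arcTrace (a : Arc G) : arcCount Set.univ (arcTrace a) = 1 := by
  classical
  rw [arcCount_arcTrace, if_pos (Set.mem_univ a)]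

theorem arcTrace_comm {a b : Arc G} (h : a.src ≠ b.src) :
    arcTrace a * arcTrace b = arcTrace b * arcTrace a :=
  PresentedMonoid.mk_eq_mk_of_rel (rels := ArcComm G) ⟨a, b, h, rfl, rfl⟩

open Classical in
/-- The word formed by the targets of the arcs starting at `v`, in their order in the trace. -/
noncomputable def targets (v : V) : TraceMonoid G →* FreeMonoid V :=
  PresentedMonoid.lift (fun a => if a.src = v then FreeMonoid.of a.tgt else 1) (by
    rintro _ _ ⟨a, b, hab, rfl, rfl⟩
    simp only [map_mul, FreeMonoid.lift_eval_of]
    split_ifs <;> simp_all)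

open Classical in
theorem targets_arcOf (v : V) {x y : V} (h : G.Adj x y) :
    targets v (arcTrace (arcOf h)) = if x = v then FreeMonoid.of y else 1 :=
  (PresentedMonoid.lift_of _ _).trans (if_congr Iff.rfl rfl rfl)

/-- The target of the first arc of a hike that starts at `v`. -/
noncomputable def Hike.firstTarget (h : Hike G) (v : V) : Option V :=
  (targets v h.toTrace).toList.head?

theorem Hike.firstTarget_of_le {h k : Hike G} (hk : h ≤ k) {v w : V}
    (hv : h.firstTarget v = some w) : k.firstTarget v = some w := by
  obtain ⟨d, rfl⟩ := hk
  have : (targets v (h * d).toTrace) = targets v h.toTrace * targets v d.toTrace :=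
    map_mul _ _ _
  unfold firstTarget at *
  rw [this, FreeMonoid.toList_mul, List.head?_append, hv]
  rfl

/-- The hike consisting of an arc and its reverse. -/
noncomputable def backAndForth {x y : V} (hxy : G.Adj x y) (hyx : G.Adj y x) : Hike G :=
  (⟨arcTrace (arcOf hxy) * arcTrace (arcOf hyx), fun v => by
    classical
    simp only [arcCount_mul, arcCount_src_arcOf, arcCount_tgt_arcOf]
    exact add_comm _ _⟩ : hikes G)

/-- The hike consisting of a loop. -/
noncomputable def loopHike {x : V} (hx : G.Adj x x) : Hike G :=
  (⟨arcTrace (arcOf hx), fun v => by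
    classical
    simp only [arcCount_src_arcOf, arcCount_tgt_arcOf]⟩ : hikes G)

/-- The hike that runs once around a triangle. -/
noncomputable def triangleHike {x y z : V} (hxy : G.Adj x y) (hyz : G.Adj y z) (hzx : G.Adj z x) :
    Hike G :=
  (⟨arcTrace (arcOf hxy) * arcTrace (arcOf hyz) * arcTrace (arcOf hzx), fun v => by
    classical
    simp only [arcCount_mul, arcCount_src_arcOf, arcCount_tgt_arcOf]
    omega⟩ : hikes G)

theorem length_backAndForth {x y : V} (hxy : G.Adj x y) (hyx : G.Adj y x) :
    (backAndForth hxy hyx).length = 2 := by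
  classical
  change arcCount _ (_ * _) = _
  simp only [arcCount_mul, arcCount_univ_arcTrace]

theorem length_loopHike {x : V} (hx : G.Adj x x) : (loopHike hx).length = 1 := by
  classical
  change arcCount _ (arcTrace _) = _
  exact arcCount_univ_arcTrace _

theorem length_triangleHike {x y z : V} (hxy : G.Adj x y) (hyz : G.Adj y z) (hzx : G.Adj z x) :
    (triangleHike hxy hyz hzx).length = 3 := by
  classical
  change arcCount _ (_ * _ * _) = _
  simp only [arcCount_mul, arcCount_univ_arcTrace]

open Classical in
theorem firstTarget_backAndForth {x y : V} (hxy : G.Adj x y) (hyx : G.Adj y x) (hne : x ≠ y)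
    (v : V) : (backAndForth hxy hyx).firstTarget v =
      if x = v then some y else if y = v then some x else none := by
  unfold Hike.firstTarget
  change (targets v (_ * _)).toList.head? = _
  rw [map_mul, targets_arcOf, targets_arcOf]
  split_ifs <;> simp_all

open Classical in
theorem firstTarget_loopHike {x : V} (hx : G.Adj x x) (v : V) :
    (loopHike hx).firstTarget v = if x = v then some x else none := by
  unfold Hike.firstTarget
  change (targets v (arcTrace _)).toList.head? = _
  rw [targets_arcOf]
  split_ifs <;> simp

theorem backAndForth_swap {x y : V} (hxy : G.Adj x y) (hyx : G.Adj y x) (hne : x ≠ y) :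
    backAndForth hxy hyx = backAndForth hyx hxy :=
  Subtype.ext (arcTrace_comm hne)

theorem backAndForth_eq_iff {x y x' y' : V} (hxy : G.Adj x y) (hyx : G.Adj y x) (hne : x ≠ y)
    (hxy' : G.Adj x' y') (hyx' : G.Adj y' x') (hne' : x' ≠ y') :
    backAndForth hxy hyx = backAndForth hxy' hyx' ↔ (x = x' ∧ y = y' ∨ x = y' ∧ y = x') := by
  constructor
  · intro h
    have h1 := firstTarget_backAndForth hxy hyx hne x
    rw [h, firstTarget_backAndForth hxy' hyx' hne'] at h1
    grind
  · rintro (⟨rfl, rfl⟩ | ⟨rfl, rfl⟩)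
    · rfl
    · exact backAndForth_swap _ _ hne

theorem loopHike_eq_iff {x y : V} (hx : G.Adj x x) (hy : G.Adj y y) :
    loopHike hx = loopHike hy ↔ x = y := by
  constructor
  · intro h
    have h1 := firstTarget_loopHike hx x
    rw [h, firstTarget_loopHike] at h1
    grind
  · rintro rfl
    rfl

/-- Two hikes with a common upper bound. -/
def Compatible (h k : Hike G) : Prop := ∃ m, h ≤ m ∧ k ≤ m

theorem compatible_of_commute {h k : Hike G} (hc : h * k = k * h) : Compatible h k :=
  ⟨h * k, ⟨k, rfl⟩, ⟨h, hc⟩⟩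

theorem Compatible.firstTarget_eq {h k : Hike G} (hc : Compatible h k) {v a b : V}
    (ha : h.firstTarget v = some a) (hb : k.firstTarget v = some b) : a = b := by
  obtain ⟨m, h1, h2⟩ := hc
  have := Hike.firstTarget_of_le h1 ha
  rw [Hike.firstTarget_of_le h2 hb] at this
  exact (Option.some.inj this).symm

theorem backAndForth_commute {x y x' y' : V} (hxy : G.Adj x y) (hyx : G.Adj y x)
    (hxy' : G.Adj x' y') (hyx' : G.Adj y' x') (h1 : x ≠ x') (h2 : x ≠ y') (h3 : y ≠ x')
    (h4 : y ≠ y') : backAndForth hxy hyx * backAndForth hxy' hyx' =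
      backAndForth hxy' hyx' * backAndForth hxy hyx := by
  refine Subtype.ext ?_
  change Commute (arcTrace _ * arcTrace _) (arcTrace _ * arcTrace _)
  exact .mul_left (.mul_right (arcTrace_comm h1) (arcTrace_comm h2))
    (.mul_right (arcTrace_comm h3) (arcTrace_comm h4))

theorem backAndForth_loopHike_commute {x y z : V} (hxy : G.Adj x y) (hyx : G.Adj y x)
    (hz : G.Adj z z) (h1 : x ≠ z) (h2 : y ≠ z) :
    backAndForth hxy hyx * loopHike hz = loopHike hz * backAndForth hxy hyx := by
  refine Subtype.ext ?_
  change Commute (arcTrace _ * arcTrace _) (arcTrace _)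
  exact .mul_left (arcTrace_comm h1) (arcTrace_comm h2)

theorem share_of_not_compatible {x y x' y' : V} (hxy : G.Adj x y) (hyx : G.Adj y x)
    (hxy' : G.Adj x' y') (hyx' : G.Adj y' x')
    (h : ¬ Compatible (backAndForth hxy hyx) (backAndForth hxy' hyx')) :
    x = x' ∨ x = y' ∨ y = x' ∨ y = y' := by
  by_contra! hn
  exact h (compatible_of_commute (backAndForth_commute _ _ _ _ hn.1 hn.2.1 hn.2.2.1 hn.2.2.2))

theorem eq_of_compatible_of_share {x y x' y' : V} (hxy : G.Adj x y) (hyx : G.Adj y x)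
    (hne : x ≠ y) (hxy' : G.Adj x' y') (hyx' : G.Adj y' x') (hne' : x' ≠ y')
    (h : Compatible (backAndForth hxy hyx) (backAndForth hxy' hyx'))
    (hs : x = x' ∨ x = y' ∨ y = x' ∨ y = y') :
    backAndForth hxy hyx = backAndForth hxy' hyx' := by
  rw [backAndForth_eq_iff hxy hyx hne hxy' hyx' hne']
  have e1 := firstTarget_backAndForth hxy hyx hne
  have e2 := firstTarget_backAndForth hxy' hyx' hne'
  have e3 := fun v a b => h.firstTarget_eq (v := v) (a := a) (b := b)
  simp only [e1, e2] at e3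
  have f1 := e3 x y y'
  have f2 := e3 x y x'
  have f3 := e3 y x y'
  have f4 := e3 y x x'
  grind

theorem share_iff {x y x' y' : V} (hxy : G.Adj x y) (hyx : G.Adj y x)
    (hne : x ≠ y) (hxy' : G.Adj x' y') (hyx' : G.Adj y' x') (hne' : x' ≠ y') :
    (x = x' ∨ x = y' ∨ y = x' ∨ y = y') ↔ backAndForth hxy hyx = backAndForth hxy' hyx' ∨
      ¬ Compatible (backAndForth hxy hyx) (backAndForth hxy' hyx') := by
  constructor
  · intro hs
    by_cases h : Compatible (backAndForth hxy hyx) (backAndForth hxy' hyx')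
    · exact Or.inl (eq_of_compatible_of_share hxy hyx hne hxy' hyx' hne' h hs)
    · exact Or.inr h
  · rintro (h | h)
    · rw [backAndForth_eq_iff hxy hyx hne hxy' hyx' hne'] at h
      tauto
    · exact share_of_not_compatible hxy hyx hxy' hyx' h

theorem backAndForth_not_commute_iff {x y x' y' : V} (hxy : G.Adj x y) (hyx : G.Adj y x)
    (hne : x ≠ y) (hxy' : G.Adj x' y') (hyx' : G.Adj y' x') (hne' : x' ≠ y') :
    backAndForth hxy hyx * backAndForth hxy' hyx' ≠ backAndForth hxy' hyx' * backAndForth hxy hyx ↔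
      backAndForth hxy hyx ≠ backAndForth hxy' hyx' ∧ (x = x' ∨ x = y' ∨ y = x' ∨ y = y') := by
  constructor
  · intro h
    refine ⟨fun he => h (by rw [he]), ?_⟩
    by_contra! hn
    exact h (backAndForth_commute _ _ _ _ hn.1 hn.2.1 hn.2.2.1 hn.2.2.2)
  · rintro ⟨h1, h2⟩ hc
    exact h1 (eq_of_compatible_of_share hxy hyx hne hxy' hyx' hne' (compatible_of_commute hc) h2)

theorem mem_iff_not_compatible_loopHike {x y z : V} (hxy : G.Adj x y) (hyx : G.Adj y x)
    (hne : x ≠ y) (hz : G.Adj z z) :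
    (x = z ∨ y = z) ↔ ¬ Compatible (backAndForth hxy hyx) (loopHike hz) := by
  constructor
  · intro hs h
    have e3 := fun v a b => h.firstTarget_eq (v := v) (a := a) (b := b)
    simp only [firstTarget_backAndForth hxy hyx hne, firstTarget_loopHike] at e3
    have f1 := e3 z y z
    have f2 := e3 z x z
    grind
  · intro h
    by_contra! hn
    exact h (compatible_of_commute (backAndForth_loopHike_commute _ _ _ hn.1 hn.2))

theorem exists_list_of_trace (t : TraceMonoid G) :
    ∃ l : List (Arc G), t = (l.map arcTrace).prod ∧ l.length = arcCount Set.univ t := by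
  classical
  obtain ⟨w, rfl⟩ := PresentedMonoid.surjective_mk t
  induction w using FreeMonoid.inductionOn' with
  | one => exact ⟨[], map_one _, (arcCount_one _).symm⟩
  | of_mul a w ih =>
    obtain ⟨l, h1, h2⟩ := ih
    refine ⟨a :: l, ?_, ?_⟩
    · rw [map_mul, h1]
      rfl
    · rw [map_mul, arcCount_mul, ← h2, List.length_cons]
      have : arcCount Set.univ (PresentedMonoid.mk (ArcComm G) (FreeMonoid.of a)) = 1 :=
        arcCount_univ_arcTrace a
      omega

theorem exists_loopHike_of_length {h : Hike G} (hl : h.length = 1) :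
    ∃ (x : V) (hx : G.Adj x x), h = loopHike hx := by
  classical
  obtain ⟨l, h1, h2⟩ := exists_list_of_trace h.toTrace
  obtain ⟨c, rfl⟩ := List.length_eq_one_iff.1 (h2.trans hl)
  obtain ⟨x, y, hxy, rfl⟩ := c.exists_eq_arcOf
  simp only [List.map_cons, List.map_nil, List.prod_cons, List.prod_nil, mul_one] at h1
  have hb := h.2 x
  change arcCount _ h.toTrace = arcCount _ h.toTrace at hb
  rw [h1, arcCount_src_arcOf, arcCount_tgt_arcOf] at hb
  obtain rfl : y = x := by
    by_contra hne
    simp [hne] at hb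
  exact ⟨y, hxy, Subtype.ext h1⟩

theorem isBacktrack_iff {h : Hike G} : IsBacktrack h ↔
    ∃ (x y : V) (hxy : G.Adj x y) (hyx : G.Adj y x), x ≠ y ∧ h = backAndForth hxy hyx := by
  constructor
  · rintro ⟨c, c', hne, h1, h2, h3⟩
    obtain ⟨x, y, hxy, rfl⟩ := c.exists_eq_arcOf
    obtain ⟨x', y', hyx, rfl⟩ := c'.exists_eq_arcOf
    simp only [arcOf_src, arcOf_tgt] at hne h1 h2
    subst h1 h2
    exact ⟨_, _, hxy, hyx, hne, Subtype.ext h3⟩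
  · rintro ⟨x, y, hxy, hyx, hne, rfl⟩
    exact ⟨arcOf hxy, arcOf hyx, hne, rfl, rfl, rfl⟩

theorem exists_of_length_two {h : Hike G} (hl : h.length = 2) : IsBacktrack h ∨
    ∃ (x y : V) (hx : G.Adj x x) (hy : G.Adj y y), h = loopHike hx * loopHike hy := by
  classical
  obtain ⟨l, h1, h2⟩ := exists_list_of_trace h.toTrace
  obtain ⟨c, c', rfl⟩ := List.length_eq_two.1 (h2.trans hl)
  obtain ⟨x, y, hxy, rfl⟩ := c.exists_eq_arcOf
  obtain ⟨x', y', hxy', rfl⟩ := c'.exists_eq_arcOf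
  simp only [List.map_cons, List.map_nil, List.prod_cons, List.prod_nil, mul_one] at h1
  have hb : ∀ v, arcCount _ h.toTrace = arcCount _ h.toTrace := h.2
  simp only [h1, arcCount_mul, arcCount_src_arcOf, arcCount_tgt_arcOf] at hb
  by_cases hloop : x = y
  · subst hloop
    obtain rfl : x' = y' := by
      have := hb x'
      grind
    exact Or.inr ⟨_, _, hxy, hxy', Subtype.ext h1⟩
  · refine Or.inl ⟨arcOf hxy, arcOf hxy', hloop, ?_, ?_, h1⟩
    · have := hb y
      simp only [arcOf_src, arcOf_tgt]
      grind
    · have := hb x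
      simp only [arcOf_src, arcOf_tgt]
      grind

theorem isBacktrack_iff_minimal (h : Hike G) :
    IsBacktrack h ↔ Minimal (fun k : Hike G => k ≠ 1) h ∧ h.length = 2 := by
  have length_one : (1 : Hike G).length = 0 := arcCount_one _
  constructor
  · rw [isBacktrack_iff]
    rintro ⟨x, y, hxy, hyx, hne, rfl⟩
    have hl := length_backAndForth hxy hyx
    refine ⟨⟨?_, fun k hk hle => ?_⟩, hl⟩
    · intro h1
      rw [h1, length_one] at hl
      omega
    · obtain ⟨d, hd⟩ := id hle
      have h1 := Hike.length_mul k d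
      rw [← hd, hl] at h1
      have h2 : k.length ≠ 0 := fun h0 => hk (k.eq_one_of_length h0)
      have h3 : k.length ≠ 1 := by
        intro h3
        obtain ⟨z, hz, rfl⟩ := exists_loopHike_of_length h3
        have h4 := Hike.firstTarget_of_le hle (v := z) (w := z) (by simp [firstTarget_loopHike])
        rw [firstTarget_backAndForth hxy hyx hne] at h4
        grind
      have h4 : d = 1 := d.eq_one_of_length (by omega)
      rw [h4, mul_one] at hd
      exact hd.le
  · rintro ⟨hmin, hl⟩
    rcases exists_of_length_two hl with hb | ⟨x, y, hx, hy, rfl⟩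
    · exact hb
    · have h1 : loopHike hx ≠ 1 := fun h1 => by
        have := length_loopHike hx
        rw [h1, length_one] at this
        omega
      obtain ⟨d, hd⟩ := hmin.2 h1 ⟨_, rfl⟩
      have h2 := congrArg Hike.length hd
      rw [Hike.length_mul, hl, length_loopHike] at h2
      omega

theorem adj_inclusive_iff (hbi : IsBidirected G) {x y : V} :
    G.toSimpleGraphInclusive.Adj x y ↔ x ≠ y ∧ G.Adj x y := by
  have := hbi x y
  have := hbi y x
  simp only [Digraph.toSimpleGraphInclusive, SimpleGraph.fromRel_adj]
  tauto

theorem backtrackGraph_iso_lineGraph (hbi : IsBidirected G) :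
    Nonempty (backtrackGraph G ≃g G.toSimpleGraphInclusive.lineGraph) := by
  have key : ∀ e : G.toSimpleGraphInclusive.edgeSet, ∃ (x y : V) (_ : G.Adj x y) (_ : G.Adj y x),
      x ≠ y ∧ e.1 = s(x, y) := by
    rintro ⟨e, he⟩
    induction e with | _ x y
    rw [SimpleGraph.mem_edgeSet, adj_inclusive_iff hbi] at he
    exact ⟨x, y, he.2, hbi _ _ he.2, he.1, rfl⟩
  choose x y hxy hyx hne he using key
  have hb : ∀ e, IsBacktrack (backAndForth (hxy e) (hyx e)) := fun e =>
    isBacktrack_iff.2 ⟨_, _, _, _, hne e, rfl⟩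
  have hinj : ∀ e f, backAndForth (hxy e) (hyx e) = backAndForth (hxy f) (hyx f) ↔ e = f := by
    intro e f
    rw [backAndForth_eq_iff _ _ (hne e) _ _ (hne f), ← Subtype.coe_inj, he, he, Sym2.eq_iff]
  let F : G.toSimpleGraphInclusive.edgeSet → {h : Hike G // IsBacktrack h} := fun e => ⟨_, hb e⟩
  have hF : Function.Bijective F := by
    refine ⟨fun e f hef => (hinj e f).1 (congrArg Subtype.val hef), ?_⟩
    rintro ⟨h, hh⟩
    obtain ⟨p, q, hpq, hqp, hn, rfl⟩ := isBacktrack_iff.1 hh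
    refine ⟨⟨s(p, q), (adj_inclusive_iff hbi).2 ⟨hn, hpq⟩⟩, Subtype.ext ?_⟩
    refine (backAndForth_eq_iff _ _ (hne _) _ _ hn).2 ?_
    rw [← Sym2.eq_iff, ← he]
  refine ⟨RelIso.symm ⟨Equiv.ofBijective F hF, fun {e f} => ?_⟩⟩
  refine (backAndForth_not_commute_iff _ _ (hne e) _ _ (hne f)).trans ?_
  rw [Ne, hinj, SimpleGraph.lineGraph_adj_iff_exists]
  refine and_congr_right fun _ => ?_
  simp only [he, Sym2.mem_iff]
  constructor
  · rintro (h | h | h | h)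
    exacts [⟨_, Or.inl rfl, Or.inl h⟩, ⟨_, Or.inl rfl, Or.inr h⟩, ⟨_, Or.inr rfl, Or.inl h⟩,
      ⟨_, Or.inr rfl, Or.inr h⟩]
  · rintro ⟨v, rfl | rfl, h | h⟩ <;> simp [h]

theorem even_length_of_star {a : V} (hloop : ∀ x, ¬ G.Adj x x)
    (hstar : ∀ x y, G.Adj x y → x = a ∨ y = a) (h : Hike G) : Even h.length := by
  classical
  have key : ∀ l : List (Arc G), arcCount Set.univ (l.map arcTrace).prod =
      arcCount {b | b.src = a} (l.map arcTrace).prod +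
        arcCount {b | b.tgt = a} (l.map arcTrace).prod := by
    intro l
    induction l with
    | nil => simp [arcCount_one]
    | cons b l ih =>
      obtain ⟨x, y, hxy, rfl⟩ := b.exists_eq_arcOf
      rw [List.map_cons, List.prod_cons]
      simp only [arcCount_mul, arcCount_univ_arcTrace, arcCount_src_arcOf,
        arcCount_tgt_arcOf, ih]
      have h1 := hstar x y hxy
      have h2 : ¬ (x = a ∧ y = a) := by
        rintro ⟨rfl, rfl⟩
        exact hloop _ hxy
      split_ifs <;> first | omega | tauto
  obtain ⟨l, h1, -⟩ := exists_list_of_trace h.toTrace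
  have h2 := key l
  rw [← h1] at h2
  have h3 : arcCount {b | b.src = a} h.toTrace = arcCount {b | b.tgt = a} h.toTrace := h.2 a
  exact ⟨_, by rw [← h3] at h2; exact h2⟩

end

section
variable {V : Type u} {W : Type v} {G : Digraph V} {H : Digraph W}

theorem compatible_map_iff (e : Hike G ≃o Hike H) {h k : Hike G} :
    Compatible (e h) (e k) ↔ Compatible h k := by
  constructor
  · rintro ⟨m, h1, h2⟩
    exact ⟨e.symm m, e.le_symm_apply.2 h1, e.le_symm_apply.2 h2⟩
  · rintro ⟨m, h1, h2⟩
    exact ⟨e m, e.le_iff_le.2 h1, e.le_iff_le.2 h2⟩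

theorem orderIso_map_one (e : Hike G ≃o Hike H) (hl : ∀ h, (e h).length = h.length) :
    e 1 = 1 :=
  Hike.eq_one_of_length _ ((hl 1).trans (arcCount_one _))

theorem isBacktrack_map (e : Hike G ≃o Hike H) (hl : ∀ h, (e h).length = h.length) {h : Hike G}
    (hb : IsBacktrack h) : IsBacktrack (e h) := by
  rw [isBacktrack_iff_minimal] at hb ⊢
  obtain ⟨⟨h1, h2⟩, h3⟩ := hb
  have he := orderIso_map_one e hl
  refine ⟨⟨fun h0 => h1 (e.injective (h0.trans he.symm)), fun k hk hle => ?_⟩, (hl h).trans h3⟩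
  have := @h2 (e.symm k) (fun h0 => hk (by rw [← he, ← h0, e.apply_symm_apply]))
    (e.symm_apply_le.2 hle)
  exact e.le_symm_apply.1 this

theorem length_orderIso_symm (e : Hike G ≃o Hike H) (hl : ∀ h, (e h).length = h.length)
    (h : Hike H) : (e.symm h).length = h.length := by
  rw [← hl, e.apply_symm_apply]

/-- The correspondence of edges given by an isomorphism of hike structures. -/
def EdgeRel (e : Hike G ≃o Hike H) (x y : V) (a b : W) : Prop :=
  x ≠ y ∧ a ≠ b ∧ ∃ (hxy : G.Adj x y) (hyx : G.Adj y x) (hab : H.Adj a b) (hba : H.Adj b a),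
    e (backAndForth hxy hyx) = backAndForth hab hba

/-- The correspondence of loops given by an isomorphism of hike structures. -/
def LoopRel (e : Hike G ≃o Hike H) (x : V) (a : W) : Prop :=
  ∃ (hx : G.Adj x x) (ha : H.Adj a a), e (loopHike hx) = loopHike ha

theorem edgeCorr_edgeRel (hG : IsBidirected G) (hH : IsBidirected H) (e : Hike G ≃o Hike H)
    (hl : ∀ h, (e h).length = h.length) :
    EdgeCorr G.toSimpleGraphInclusive H.toSimpleGraphInclusive (EdgeRel e) where
  left := fun ⟨h1, _, h3, _⟩ => (adj_inclusive_iff hG).2 ⟨h1, h3⟩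
  right := fun ⟨_, h2, _, _, h3, _⟩ => (adj_inclusive_iff hH).2 ⟨h2, h3⟩
  swap_left := fun ⟨h1, h2, h3, h4, h5, h6, h7⟩ =>
    ⟨h1.symm, h2, h4, h3, h5, h6, by rw [← h7, backAndForth_swap _ _ h1]⟩
  swap_right := fun ⟨h1, h2, h3, h4, h5, h6, h7⟩ =>
    ⟨h1, h2.symm, h3, h4, h6, h5, by rw [h7, backAndForth_swap _ _ h2]⟩
  total_left := by
    intro x y hxy
    rw [adj_inclusive_iff hG] at hxy
    obtain ⟨hne, hxy⟩ := hxy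
    have hyx := hG _ _ hxy
    obtain ⟨a, b, hab, hba, hn, h⟩ := isBacktrack_iff.1
      (isBacktrack_map e hl (isBacktrack_iff.2 ⟨x, y, hxy, hyx, hne, rfl⟩))
    exact ⟨a, b, hne, hn, hxy, hyx, hab, hba, h⟩
  total_right := by
    intro a b hab
    rw [adj_inclusive_iff hH] at hab
    obtain ⟨hne, hab⟩ := hab
    have hba := hH _ _ hab
    obtain ⟨x, y, hxy, hyx, hn, h⟩ := isBacktrack_iff.1
      (isBacktrack_map e.symm (length_orderIso_symm e hl)
        (isBacktrack_iff.2 ⟨a, b, hab, hba, hne, rfl⟩))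
    exact ⟨x, y, hn, hne, hxy, hyx, hab, hba, by rw [← h, e.apply_symm_apply]⟩
  meet := by
    rintro x y a b x' y' a' b' ⟨h1, h2, h3, h4, h5, h6, h7⟩ ⟨k1, k2, k3, k4, k5, k6, k7⟩
    rw [share_iff h3 h4 h1 k3 k4 k1, share_iff h5 h6 h2 k5 k6 k2, ← h7, ← k7,
      compatible_map_iff, e.injective.eq_iff]
  same := by
    rintro x y a b x' y' a' b' ⟨h1, h2, h3, h4, h5, h6, h7⟩ ⟨k1, k2, k3, k4, k5, k6, k7⟩
    rw [← backAndForth_eq_iff h3 h4 h1 k3 k4 k1, ← backAndForth_eq_iff h5 h6 h2 k5 k6 k2, ← h7,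
      ← k7, e.injective.eq_iff]

theorem loopCorr_loopRel (e : Hike G ≃o Hike H) (hl : ∀ h, (e h).length = h.length) :
    LoopCorr (fun v => G.Adj v v) (fun w => H.Adj w w) (EdgeRel e) (LoopRel e) where
  left := fun ⟨h, _⟩ => h
  right := fun ⟨_, h, _⟩ => h
  total_left := by
    intro v hv
    obtain ⟨w, hw, h⟩ := exists_loopHike_of_length ((hl (loopHike hv)).trans (length_loopHike hv))
    exact ⟨w, hv, hw, h⟩
  total_right := by
    intro w hw
    obtain ⟨v, hv, h⟩ := exists_loopHike_of_length
      ((length_orderIso_symm e hl (loopHike hw)).trans (length_loopHike hw))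
    exact ⟨v, hv, hw, by rw [← h, e.apply_symm_apply]⟩
  same := by
    rintro v w v' w' ⟨h1, h2, h3⟩ ⟨k1, k2, k3⟩
    rw [← loopHike_eq_iff h1 k1, ← loopHike_eq_iff h2 k2, ← h3, ← k3, e.injective.eq_iff]
  inc := by
    rintro x y a b v w ⟨h1, h2, h3, h4, h5, h6, h7⟩ ⟨k1, k2, k3⟩
    rw [mem_iff_not_compatible_loopHike h3 h4 h1 k1, mem_iff_not_compatible_loopHike h5 h6 h2 k2,
      ← h7, ← k3, compatible_map_iff]

theorem no_triangle_of_star (hG : IsBidirected G) (hH : IsBidirected H) (e : Hike G ≃o Hike H)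
    (hl : ∀ h, (e h).length = h.length) (a : W)
    (hstar : ∀ x y, H.toSimpleGraphInclusive.Adj x y → x = a ∨ y = a)
    (hloop : ∀ w, ¬ H.Adj w w) (i j k : V) (hij : G.toSimpleGraphInclusive.Adj i j)
    (hjk : G.toSimpleGraphInclusive.Adj j k) (hki : G.toSimpleGraphInclusive.Adj k i) : False := by
  rw [adj_inclusive_iff hG] at hij hjk hki
  have h1 := even_length_of_star hloop (a := a) (fun x y hxy => hstar x y
    ((adj_inclusive_iff hH).2 ⟨fun h => hloop y (h ▸ hxy), hxy⟩))
    (e (triangleHike hij.2 hjk.2 hki.2))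
  rw [hl, length_triangleHike] at h1
  exact absurd h1 (by decide)

theorem SameHikeStructure.nonempty_relIso (hG : IsBidirected G) (hH : IsBidirected H)
    (hGc : IsConnected G) (hHc : IsConnected H) (h : SameHikeStructure G H) :
    Nonempty (G.Adj ≃r H.Adj) := by
  obtain ⟨e, hl⟩ := h
  obtain ⟨f, h1, h2⟩ := (edgeCorr_edgeRel hG hH e hl).loopIso (loopCorr_loopRel e hl) hGc hHc
    (no_triangle_of_star hG hH e hl)
    (no_triangle_of_star hH hG e.symm (length_orderIso_symm e hl))
  refine ⟨f, fun {x y} => ?_⟩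
  by_cases hxy : x = y
  · subst hxy
    exact (h2 x).symm
  · have := h1 x y
    rw [adj_inclusive_iff hG, adj_inclusive_iff hH] at this
    have hf : f x ≠ f y := fun he => hxy (f.injective he)
    tauto

end

end HikePoset

theorem mainTheorem2 {V : Type*} [Finite V] (G : Digraph V)
    (hbi : HikePoset.IsBidirected G) (hconn : HikePoset.IsConnected G) :
    (∀ h : HikePoset.Hike G,
      HikePoset.IsBacktrack h ↔ Minimal (fun k : HikePoset.Hike G => k ≠ 1) h ∧ h.length = 2) ∧
    Nonempty (HikePoset.backtrackGraph G ≃g G.toSimpleGraphInclusive.lineGraph) ∧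
    (∀ {W : Type*} [Finite W] (H : Digraph W),
      HikePoset.IsBidirected H → HikePoset.IsConnected H →
      HikePoset.SameHikeStructure G H → Nonempty (G.Adj ≃r H.Adj)) := by
  exact ⟨HikePoset.isBacktrack_iff_minimal, HikePoset.backtrackGraph_iso_lineGraph hbi,
    fun H hH hHc h => h.nonempty_relIso hbi hH hconn hHc⟩
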